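/- Let $\mathbb K\in\{\mathbb R,\mathbb C\}$ and let $\mathbb M_{n_1,n_2}$ be the space of $n_1\times n_2$ matrices over $\mathbb K$ with the Frobenius norm $\|\cdot\|$. Let $H$ be a finite-dimensional real inner product space (for instance $\mathbb R^m$ or $\mathbb C^m$ with the Euclidean norm), let $\mathcal A:\mathbb M_{n_1,n_2}\to H$ be an $\mathbb R$-linear operator with operator norm $\|\mathcal A\|$, and let $K\ge 1$. For a matrix $X$ let $\sigma_1(X)\ge\sigma_2(X)\ge\dots$ be its singular values, and define $\delta_{2K}^-$ by $$1-\delta_{2K}^-=\inf\Big\{\frac{\|\mathcal A X\|^2}{\|X\|^2}:\ X\ne 0,\ \operatorname{rank}X\le 2K\Big\}.$$ Put $\iota_{R_K}(X)=0$ if $\operatorname{rank}X\le K$ and $\iota_{R_K}(X)=\infty$ otherwise. For $f:\mathbb M_{n_1,n_2}\to[-\infty,\infty]$ let $\mathcal S_2(f)(Y)=\sup_X\big(-f(X)-\|X-Y\|^2\big)$, and let $\mathcal Q_2=\mathcal S_2\circ\mathcal S_2$ (the quadratic envelope). **Theorem.** Suppose that $b=\mathcal A X_0+\epsilon$ with $X_0\in\mathbb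 M_{n_1,n_2}$ and $\epsilon\in H$, that $\|\mathcal A\|<1$, $\delta_{2K}^-<1/2$, $\operatorname{rank}X_0=K$, and that $$\sigma_K(X_0)>\frac{5}{(1-2\delta_{2K}^-)^{3/2}}\,\|\epsilon\|.$$ Then the problem $\operatorname{argmin}_{\operatorname{rank}X\le K}\|\mathcal A X-b\|$ has a unique solution $X_B$ (the best rank $K$ solution). Moreover $X_B$ is the unique global minimizer of $$\mathcal R_{K,reg}(X)=\mathcal Q_2(\iota_{R_K})(X)+\|\mathcal A X-b\|^2,\qquad X\in\mathbb M_{n_1,n_2},$$ this functional has no local minimizer other than $X_B$, and $$\|X_B-X_0\|\le\frac{2\|\epsilon\|}{\sqrt{1-\delta_{2K}^-}}.$$ -/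

import Mathlib

open scoped Topology

-- Matrices carry the Frobenius norm throughout.
attribute [local instance] Matrix.frobeniusNormedAddCommGroup Matrix.frobeniusNormedSpace

noncomputable section

namespace LowRank

/-- The transform `S_γ(f)(Y) = sup_X (-f(X) - (γ/2)‖X - Y‖²)` of an extended-real-valued function. -/
def quadTransform {V : Type*} [NormedAddCommGroup V] (γ : ℝ) (f : V → EReal) (Y : V) : EReal :=
  ⨆ X : V, (-f X - ((γ / 2 * ‖X - Y‖ ^ 2 : ℝ) : EReal))

/-- The quadratic envelope `Q_γ(f) = S_γ(S_γ(f))`. -/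
def quadEnvelope {V : Type*} [NormedAddCommGroup V] (γ : ℝ) (f : V → EReal) : V → EReal :=
  quadTransform γ (quadTransform γ f)

/-- The operator norm of a linear map on a finite-dimensional normed space. -/
def opNorm {V W : Type*} [NormedAddCommGroup V] [NormedSpace ℝ V] [FiniteDimensional ℝ V]
    [NormedAddCommGroup W] [NormedSpace ℝ W] (A : V →ₗ[ℝ] W) : ℝ :=
  ‖LinearMap.toContinuousLinearMap A‖

variable {𝕜 : Type*} [RCLike 𝕜] {n₁ n₂ : ℕ}

open Classical in
/-- The indicator functional `ι_{R_K}`: `0` on matrices of rank at most `K`, and `∞` elsewhere. -/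
def rankIndicator (K : ℕ) (X : Matrix (Fin n₁) (Fin n₂) 𝕜) : EReal :=
  if X.rank ≤ K then 0 else ⊤

/-- The `j`-th largest singular value `σ_j(X)`, `j = 1, 2, …` (Mathlib's sequence starts at `0`). -/
def sigma (X : Matrix (Fin n₁) (Fin n₂) 𝕜) (j : ℕ) : ℝ :=
  (Matrix.toEuclideanLin X).singularValues (j - 1)

variable {H : Type*} [NormedAddCommGroup H] [InnerProductSpace ℝ H]

/-- The lower restricted isometry constant `δ_k⁻`, defined by
`1 - δ_k⁻ = inf {‖A X‖² / ‖X‖² : X ≠ 0, rank X ≤ k}`. -/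
def lrip (A : Matrix (Fin n₁) (Fin n₂) 𝕜 →ₗ[ℝ] H) (k : ℕ) : ℝ :=
  1 - sInf {r : ℝ | ∃ X : Matrix (Fin n₁) (Fin n₂) 𝕜,
    X ≠ 0 ∧ X.rank ≤ k ∧ r = ‖A X‖ ^ 2 / ‖X‖ ^ 2}

/-- `X` solves the best rank `K` problem `argmin_{rank X ≤ K} ‖A X - b‖`. -/
def IsBestRank (A : Matrix (Fin n₁) (Fin n₂) 𝕜 →ₗ[ℝ] H) (b : H) (K : ℕ)
    (X : Matrix (Fin n₁) (Fin n₂) 𝕜) : Prop :=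
  X.rank ≤ K ∧ ∀ Y : Matrix (Fin n₁) (Fin n₂) 𝕜, Y.rank ≤ K → ‖A X - b‖ ≤ ‖A Y - b‖

/-- The regularized functional `Q_2(ι_{R_K})(X) + ‖A X - b‖²`. -/
def regFunctional (A : Matrix (Fin n₁) (Fin n₂) 𝕜 →ₗ[ℝ] H) (b : H) (K : ℕ)
    (X : Matrix (Fin n₁) (Fin n₂) 𝕜) : EReal :=
  quadEnvelope 2 (rankIndicator K) X + ((‖A X - b‖ ^ 2 : ℝ) : EReal)

end LowRank

end

/-! Let `C` be the set of matrices of rank at most `K`. Then `Q_2(ι_C)(Y) = sup_Z (d(Z, C)² - ‖Z -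
Y‖²)`. The supremum is attained, and at a maximizer `Z` the point `Y` lies in the convex hull of the
set `M` of points of `C` nearest to `Z` (`mem_convexHull_nearest`). On that hull the same `Z` stays
optimal, so the regularized functional equals `d(Z, C)² - ‖Z - X‖² + ‖A X - b‖²`, which is strictly
concave because `‖A‖ < 1`. Hence a local minimizer is an extreme point of the hull and lies in `C`
(`mem_of_isLocalMin`), and a minimizer of `‖A X - b‖` over `C` is a global minimizer
(`forall_le_of_isMinOn`).

For uniqueness, a local minimizer `Y` satisfies `0 ≤ ‖W - Y‖² + 2⟨A Y - b, A(W - Y)⟩` for all `W` in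
`C`. Taken at two local minimizers, these conditions alone do not force equality. At a best solution
`X`, however, the condition says that `X` is a nearest point of `C` to `X + E`, where `E = A*(b - A
X)`; thus `E` is orthogonal to the row and column spaces of `X`. The hypothesis on `σ_K(X₀)` makes
`σ_K(X)` dominate `τ‖E‖` with `τ = 2/(1 - 2δ)`, so by Eckart–Young `X` is also nearest to `X + τE`
(`two_mul_inner_le_of_rank_le`). This strengthened condition at `X`, the plain one at `Y` and `‖A(Y
- X)‖² ≥ (1 - δ)‖Y - X‖²` give `Y = X`. -/

/-- In finite dimension, the convex hull of a compact set is compact. -/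
theorem IsCompact.convexHull_of_finiteDimensional {V : Type*} [NormedAddCommGroup V]
    [NormedSpace ℝ V] [FiniteDimensional ℝ V] {s : Set V} (hs : IsCompact s) :
    IsCompact (convexHull ℝ s) := by
  classical
  rcases s.eq_empty_or_nonempty with rfl | ⟨p, hp⟩
  · simp
  -- Carathéodory: `dim V + 1` points always suffice, so the hull is a continuous image of a simplex
  -- times a power of `s`.
  set d := Module.finrank ℝ V + 1
  let F : (Fin d → ℝ) × (Fin d → V) → V := fun q ↦ ∑ i, q.1 i • q.2 i
  have hF : Continuous F := by fun_prop
  have hc : IsCompact (stdSimplex ℝ (Fin d) ×ˢ Set.univ.pi fun _ : Fin d ↦ s) :=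
    (isCompact_stdSimplex ℝ (Fin d)).prod (isCompact_univ_pi fun _ ↦ hs)
  convert hc.image hF
  apply Set.Subset.antisymm
  · intro x hx
    obtain ⟨ι, _, z, w, hz, haff, hw, hw1, hx⟩ := eq_pos_convex_span_of_mem_convexHull hx
    have hcard : Fintype.card ι ≤ Fintype.card (Fin d) := by
      rw [Fintype.card_fin]
      exact haff.card_le_finrank_succ.trans
        (Nat.add_le_add_right (Submodule.finrank_le _) 1)
    obtain ⟨e⟩ := Function.Embedding.nonempty_of_card_le hcard
    have hw' : ∀ i, Function.extend e w 0 (e i) = w i := e.injective.extend_apply _ _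
    have hz' : ∀ i, Function.extend e z (fun _ ↦ p) (e i) = z i := e.injective.extend_apply _ _
    -- Unused slots get weight `0` and the dummy point `p`.
    refine ⟨(Function.extend e w 0, Function.extend e z fun _ ↦ p), ⟨⟨fun j ↦ ?_, ?_⟩, ?_⟩, ?_⟩
    · by_cases h : ∃ i, e i = j
      · obtain ⟨i, rfl⟩ := h
        simpa [hw'] using (hw i).le
      · simp [Function.extend_apply' _ _ _ h]
    · rw [← hw1]
      symm
      refine Finset.sum_of_injOn e e.injective.injOn (by simp) (fun j _ hj ↦ ?_)
        (fun i _ ↦ (hw' i).symm)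
      have h : ¬ ∃ i, e i = j := by simpa using hj
      simp [Function.extend_apply' _ _ _ h]
    · intro j _
      by_cases h : ∃ i, e i = j
      · obtain ⟨i, rfl⟩ := h
        simpa [hz'] using hz ⟨i, rfl⟩
      · simpa [Function.extend_apply' _ _ _ h] using hp
    · rw [← hx]
      symm
      refine Finset.sum_of_injOn e e.injective.injOn (by simp) (fun j _ hj ↦ ?_)
        (fun i _ ↦ ?_)
      · have h : ¬ ∃ i, e i = j := by simpa using hj
        simp [Function.extend_apply' _ _ _ h]
      · simp [hw', hz']
  · rintro _ ⟨⟨w, z⟩, ⟨hw, hz⟩, rfl⟩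
    exact (convex_convexHull ℝ s).sum_mem (fun i _ ↦ hw.1 i) hw.2
      fun i _ ↦ subset_convexHull ℝ s (hz i trivial)

/-! ### Quadratic envelope of an indicator functional -/

namespace LowRank

open Metric

section Envelope

variable {V : Type*} [NormedAddCommGroup V] {C : Set V} {f : V → EReal}

/-- `f` is the indicator functional of `C`: `0` on `C` and `∞` elsewhere. -/
def IsIndicator (f : V → EReal) (C : Set V) : Prop :=
  (∀ X ∈ C, f X = 0) ∧ ∀ X ∉ C, f X = ⊤

/-- Points outside `C` contribute `-∞`, and at `γ = 2` the weight `γ/2` is `1`. What remains is the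
supremum of `-‖X - Y‖²` over `C`, attained because `C` is closed in a proper space. -/
theorem quadTransform_indicator [ProperSpace V] (hf : IsIndicator f C) (hC : IsClosed C)
    (hne : C.Nonempty) (Y : V) :
    quadTransform 2 f Y = ((-(infDist Y C) ^ 2 : ℝ) : EReal) := by
  apply le_antisymm
  · refine iSup_le fun X ↦ ?_
    by_cases hX : X ∈ C
    · rw [hf.1 X hX, neg_zero, zero_sub, ← EReal.coe_neg, EReal.coe_le_coe_iff]
      have h := infDist_le_dist_of_mem (x := Y) hX
      rw [dist_comm, dist_eq_norm] at h
      have := pow_le_pow_left₀ infDist_nonneg h 2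
      linarith
    · rw [hf.2 X hX, EReal.neg_top, EReal.bot_sub]
      exact bot_le
  · obtain ⟨X, hX, h⟩ := hC.exists_infDist_eq_dist hne Y
    refine le_iSup_of_le X ?_
    rw [hf.1 X hX, neg_zero, zero_sub, ← EReal.coe_neg, EReal.coe_le_coe_iff, h, dist_comm,
      dist_eq_norm]
    linarith

theorem quadEnvelope_indicator [ProperSpace V] (hf : IsIndicator f C) (hC : IsClosed C)
    (hne : C.Nonempty) (Y : V) :
    quadEnvelope 2 f Y = ⨆ Z, (((infDist Z C) ^ 2 - ‖Z - Y‖ ^ 2 : ℝ) : EReal) := by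
  unfold quadEnvelope
  rw [quadTransform]
  refine iSup_congr fun Z ↦ ?_
  rw [quadTransform_indicator hf hC hne, ← EReal.coe_neg, ← EReal.coe_sub]
  congr 2 <;> ring

theorem le_quadEnvelope_indicator [ProperSpace V] (hf : IsIndicator f C) (hC : IsClosed C)
    (hne : C.Nonempty) (Z Y : V) :
    (((infDist Z C) ^ 2 - ‖Z - Y‖ ^ 2 : ℝ) : EReal) ≤ quadEnvelope 2 f Y := by
  rw [quadEnvelope_indicator hf hC hne]
  exact le_iSup (fun Z ↦ (((infDist Z C) ^ 2 - ‖Z - Y‖ ^ 2 : ℝ) : EReal)) Z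

theorem quadEnvelope_indicator_le [ProperSpace V] (hf : IsIndicator f C) (hC : IsClosed C)
    (hne : C.Nonempty) {Y : V} {a : ℝ}
    (h : ∀ Z, (infDist Z C) ^ 2 - ‖Z - Y‖ ^ 2 ≤ a) : quadEnvelope 2 f Y ≤ (a : EReal) := by
  rw [quadEnvelope_indicator hf hC hne]
  exact iSup_le fun Z ↦ EReal.coe_le_coe_iff.2 (h Z)

theorem quadEnvelope_indicator_nonneg [ProperSpace V] (hf : IsIndicator f C) (hC : IsClosed C)
    (hne : C.Nonempty) (Y : V) : 0 ≤ quadEnvelope 2 f Y := by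
  refine le_trans ?_ (le_quadEnvelope_indicator hf hC hne Y Y)
  rw [← EReal.coe_zero, EReal.coe_le_coe_iff]
  simp [sq_nonneg]

theorem infDist_sq_sub_norm_sq_nonpos {X : V} (hX : X ∈ C) (Z : V) :
    (infDist Z C) ^ 2 - ‖Z - X‖ ^ 2 ≤ 0 := by
  have h := infDist_le_dist_of_mem (x := Z) hX
  rw [dist_eq_norm] at h
  have := pow_le_pow_left₀ infDist_nonneg h 2
  linarith

theorem quadEnvelope_indicator_of_mem [ProperSpace V] (hf : IsIndicator f C) (hC : IsClosed C)
    (hne : C.Nonempty) {X : V} (hX : X ∈ C) : quadEnvelope 2 f X = 0 := by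
  refine le_antisymm ?_ (quadEnvelope_indicator_nonneg hf hC hne X)
  exact_mod_cast quadEnvelope_indicator_le hf hC hne (infDist_sq_sub_norm_sq_nonpos hX)

end Envelope

end LowRank

/-! ### Maximizers in the envelope and hulls of nearest points -/

namespace LowRank

open Metric Filter

section Convexity

variable {V : Type*} [NormedAddCommGroup V] [InnerProductSpace ℝ V]

/-- The defect `a b ‖x - y‖²` does not depend on `z`. It cancels when two such expressions are
compared, and it measures concavity when a data term is added. -/
theorem norm_sub_sq_convex_combination (x y z : V) {a b : ℝ} (hab : a + b = 1) :
    ‖z - (a • x + b • y)‖ ^ 2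
      = a * ‖z - x‖ ^ 2 + b * ‖z - y‖ ^ 2 - a * b * ‖x - y‖ ^ 2 := by
  obtain rfl : b = 1 - a := by linarith
  have e1 : z - (a • x + (1 - a) • y) = (z - y) - a • (x - y) := by module
  have e2 : z - x = (z - y) - (x - y) := by module
  rw [e1, e2, norm_sub_sq_real (z - y), norm_sub_sq_real (z - y), real_inner_smul_right, norm_smul, mul_pow,
    Real.norm_eq_abs, sq_abs]
  ring

/-- The data fidelity term along a convex combination. -/
theorem norm_map_sub_sq_convex_combination {H : Type*} [NormedAddCommGroup H]
    [InnerProductSpace ℝ H] (A : V →ₗ[ℝ] H) (b : H) (x y : V) {s t : ℝ}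
    (hst : s + t = 1) :
    ‖A (s • x + t • y) - b‖ ^ 2
      = s * ‖A x - b‖ ^ 2 + t * ‖A y - b‖ ^ 2 - s * t * ‖A (x - y)‖ ^ 2 := by
  rw [map_add, map_smul, map_smul, norm_sub_rev, norm_sub_sq_convex_combination _ _ _ hst, map_sub,
    norm_sub_rev b, norm_sub_rev b]

/-- On the convex hull of `M ⊆ C`, where `M` lies in the sphere about `Z` of radius `d(Z, C)`, the
function `d(Z', C)² - ‖Z' - Y‖²` is largest at `Z' = Z`. -/
theorem infDist_sq_sub_le_of_mem_convexHull {C M : Set V} {Z : V}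
    (hM : ∀ W ∈ M, W ∈ C ∧ ‖Z - W‖ = infDist Z C) {Y : V} (hY : Y ∈ convexHull ℝ M) (Z' : V) :
    (infDist Z' C) ^ 2 - ‖Z' - Y‖ ^ 2 ≤ (infDist Z C) ^ 2 - ‖Z - Y‖ ^ 2 := by
  -- The terms `‖Y‖²` cancel, so the inequality is affine in `Y` and need only be checked on `M`.
  have hconv : Convex ℝ {Y : V |
      (infDist Z' C) ^ 2 - ‖Z' - Y‖ ^ 2 ≤ (infDist Z C) ^ 2 - ‖Z - Y‖ ^ 2} := by
    intro x hx y hy a b ha hb hab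
    simp only [Set.mem_ofPred_eq] at hx hy ⊢
    rw [norm_sub_sq_convex_combination x y Z' hab, norm_sub_sq_convex_combination x y Z hab]
    obtain rfl : b = 1 - a := by linarith
    nlinarith [mul_le_mul_of_nonneg_left hx ha, mul_le_mul_of_nonneg_left hy hb]
  refine convexHull_min (fun W hW ↦ ?_) hconv hY
  simp only [Set.mem_ofPred_eq]
  rw [(hM W hW).2, sub_self]
  exact infDist_sq_sub_norm_sq_nonpos (hM W hW).1 Z'

variable [FiniteDimensional ℝ V]

/-- The supremum defining the quadratic envelope of the indicator is attained. -/
theorem exists_forall_infDist_sq_sub_le {C : Set V} (h0 : (0 : V) ∈ C) {c : ℝ} (hc : 0 < c)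
    (hcoer : ∀ Z, (infDist Z C) ^ 2 ≤ (1 - c) * ‖Z‖ ^ 2) (Y : V) :
    ∃ Z, ∀ Z', (infDist Z' C) ^ 2 - ‖Z' - Y‖ ^ 2 ≤ (infDist Z C) ^ 2 - ‖Z - Y‖ ^ 2 := by
  have hcont : Continuous fun Z ↦ (infDist Z C) ^ 2 - ‖Z - Y‖ ^ 2 :=
    ((continuous_infDist_pt C).pow 2).sub (by fun_prop)
  refine hcont.exists_forall_ge' 0 ?_
  -- Beyond this radius `c‖Z‖² ≥ 2‖Z‖‖Y‖`, so the value at `Z` is at most `-‖Y‖²`, the value at `0`.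
  filter_upwards [(tendsto_norm_cocompact_atTop (E := V)).eventually_ge_atTop (2 * ‖Y‖ / c)]
    with Z hZ
  rw [div_le_iff₀ hc] at hZ
  rw [infDist_zero_of_mem h0, norm_sub_sq_real, zero_sub, norm_neg]
  nlinarith [hcoer Z, real_inner_le_norm Z Y, norm_nonneg Z, mul_le_mul_of_nonneg_left hZ (norm_nonneg Z)]

/-- If `Z` attains the supremum defining the quadratic envelope at `Y`, then `Y` is a convex
combination of points of `C` nearest to `Z`. -/
theorem mem_convexHull_nearest {C : Set V} (hC : IsClosed C) (hne : C.Nonempty) {Y Z : V}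
    (hZ : ∀ Z', (infDist Z' C) ^ 2 - ‖Z' - Y‖ ^ 2 ≤ (infDist Z C) ^ 2 - ‖Z - Y‖ ^ 2) :
    Y ∈ convexHull ℝ {W | W ∈ C ∧ ‖Z - W‖ = infDist Z C} := by
  set M := {W | W ∈ C ∧ ‖Z - W‖ = infDist Z C} with hMdef
  have hMc : IsCompact M := by
    refine (isCompact_closedBall Z (infDist Z C)).of_isClosed_subset ?_ ?_
    · exact hC.inter (isClosed_eq (by fun_prop) continuous_const)
    · intro W hW
      rw [mem_closedBall', dist_eq_norm]
      exact hW.2.le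
  by_contra hY
  obtain ⟨g, u, hgM, hgY⟩ := geometric_hahn_banach_closed_point (convex_convexHull ℝ M)
    hMc.convexHull_of_finiteDimensional.isClosed hY
  set D := (InnerProductSpace.toDual ℝ V).symm g with hD
  have hgD : ∀ W, g W = inner ℝ D W := fun W ↦ by
    rw [hD, InnerProductSpace.toDual_symm_apply]
  let t : ℕ → ℝ := fun n ↦ 1 / ((n : ℝ) + 1)
  have ht : ∀ n, 0 < t n := fun n ↦ Nat.one_div_pos_of_nat
  have htlim : Tendsto t atTop (𝓝 0) := tendsto_one_div_add_atTop_nhds_zero_nat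
  -- Pushing `Z` in the separating direction `D` and using its optimality, the nearest points `W n`
  -- of `Zn n` satisfy `g Y ≤ g (W n)`. A limit point of them lies in `M`, against the separation.
  let Zn : ℕ → V := fun n ↦ Z + t n • D
  have hZn : Tendsto Zn atTop (𝓝 Z) := by
    simpa using tendsto_const_nhds.add (htlim.smul_const D)
  choose W hWC hWd using fun n ↦ hC.exists_infDist_eq_dist hne (Zn n)
  have hWin : ∀ n, g Y ≤ g (W n) := by
    intro n
    have h1 := hZ (Zn n)
    rw [hWd n, dist_eq_norm] at h1
    have h2 : infDist Z C ^ 2 ≤ ‖Z - W n‖ ^ 2 :=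
      pow_le_pow_left₀ infDist_nonneg (by rw [← dist_eq_norm]; exact infDist_le_dist_of_mem (hWC n)) 2
    have e1 : Zn n - W n = (Z - W n) + t n • D := by simp only [Zn]; abel
    have e2 : Zn n - Y = (Z - Y) + t n • D := by simp only [Zn]; abel
    rw [e1, e2, norm_add_sq_real, norm_add_sq_real, real_inner_smul_right, real_inner_smul_right,
      inner_sub_left, inner_sub_left, real_inner_comm D (W n), real_inner_comm D Y] at h1
    rw [hgD, hgD]
    have h3 : t n * (inner ℝ D Y) ≤ t n * (inner ℝ D (W n)) := by nlinarith
    exact le_of_mul_le_mul_left h3 (ht n)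
  have hdlim : Tendsto (fun n ↦ infDist (Zn n) C) atTop (𝓝 (infDist Z C)) :=
    ((continuous_infDist_pt C).tendsto Z).comp hZn
  have hbdd : Bornology.IsBounded (Set.range W) := by
    obtain ⟨R, hR⟩ := (hdlim.norm.add hZn.norm).bddAbove_range
    refine isBounded_iff_forall_norm_le.2 ⟨R, ?_⟩
    rintro _ ⟨n, rfl⟩
    have h1 : ‖infDist (Zn n) C‖ + ‖Zn n‖ ≤ R := hR ⟨n, rfl⟩
    rw [hWd n, Real.norm_of_nonneg dist_nonneg, dist_eq_norm] at h1
    have h2 := norm_sub_norm_le (W n) (Zn n)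
    rw [norm_sub_rev] at h2
    linarith
  obtain ⟨W₀, -, ψ, hψ, hW₀⟩ := tendsto_subseq_of_bounded hbdd fun n ↦ Set.mem_range_self n
  have hW₀M : W₀ ∈ M := by
    refine ⟨hC.mem_of_tendsto hW₀ (Eventually.of_forall fun n ↦ hWC _), ?_⟩
    refine tendsto_nhds_unique (((hZn.comp hψ.tendsto_atTop).sub hW₀).norm) ?_
    refine (hdlim.comp hψ.tendsto_atTop).congr fun n ↦ ?_
    simp [hWd, dist_eq_norm]
  have h1 : g Y ≤ g W₀ := ge_of_tendsto ((g.continuous.tendsto W₀).comp hW₀)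
    (Eventually.of_forall fun n ↦ hWin _)
  linarith [hgM W₀ (subset_convexHull ℝ M hW₀M)]

end Convexity

/-! ### Minimizers of the regularized functional -/

section Minimizers

variable {V : Type*} [NormedAddCommGroup V] [InnerProductSpace ℝ V] [FiniteDimensional ℝ V]
  {H : Type*} [NormedAddCommGroup H] [InnerProductSpace ℝ H]
  {C : Set V} {f : V → EReal}

/-- A minimizer of `‖A X - b‖` over `C` is a global minimizer of the regularized functional. -/
theorem forall_le_of_isMinOn (hf : IsIndicator f C) (hC : IsClosed C) (h0 : (0 : V) ∈ C)
    {c : ℝ} (hc : 0 < c) (hcoer : ∀ Z, (infDist Z C) ^ 2 ≤ (1 - c) * ‖Z‖ ^ 2)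
    {A : V →ₗ[ℝ] H} (hA : ∀ X, ‖A X‖ ≤ ‖X‖) {b : H} {X : V}
    (hX : X ∈ C) (hmin : ∀ W ∈ C, ‖A X - b‖ ≤ ‖A W - b‖) (Y : V) :
    quadEnvelope 2 f X + ((‖A X - b‖ ^ 2 : ℝ) : EReal)
      ≤ quadEnvelope 2 f Y + ((‖A Y - b‖ ^ 2 : ℝ) : EReal) := by
  obtain ⟨Z, hZ⟩ := exists_forall_infDist_sq_sub_le h0 hc hcoer Y
  have hY := mem_convexHull_nearest hC ⟨0, h0⟩ hZ
  rw [quadEnvelope_indicator_of_mem hf hC ⟨0, h0⟩ hX, zero_add]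
  refine le_trans ?_ (add_le_add_left (le_quadEnvelope_indicator hf hC ⟨0, h0⟩ Z Y) _)
  rw [← EReal.coe_add, EReal.coe_le_coe_iff]
  -- For `‖A‖ ≤ 1` the right side is concave in `Y`, so its superlevel set is convex.
  have hconv : Convex ℝ {Y : V |
      ‖A X - b‖ ^ 2 ≤ infDist Z C ^ 2 - ‖Z - Y‖ ^ 2 + ‖A Y - b‖ ^ 2} := by
    intro x hx y hy s t hs ht hst
    simp only [Set.mem_ofPred_eq] at hx hy ⊢
    rw [norm_sub_sq_convex_combination x y Z hst, norm_map_sub_sq_convex_combination A b x y hst]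
    have h1 : ‖A (x - y)‖ ^ 2 ≤ ‖x - y‖ ^ 2 := pow_le_pow_left₀ (norm_nonneg _) (hA _) 2
    obtain rfl : t = 1 - s := by linarith
    nlinarith [mul_le_mul_of_nonneg_left hx hs, mul_le_mul_of_nonneg_left hy ht,
      mul_le_mul_of_nonneg_left h1 (mul_nonneg hs ht)]
  refine convexHull_min (fun W hW ↦ ?_) hconv hY
  simp only [Set.mem_ofPred_eq]
  rw [hW.2, sub_self, zero_add]
  exact pow_le_pow_left₀ (norm_nonneg _) (hmin W hW.1) 2

/-- A local minimizer of the regularized functional lies in `C`. -/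
theorem mem_of_isLocalMin (hf : IsIndicator f C) (hC : IsClosed C) (h0 : (0 : V) ∈ C)
    {c : ℝ} (hc : 0 < c) (hcoer : ∀ Z, (infDist Z C) ^ 2 ≤ (1 - c) * ‖Z‖ ^ 2)
    {A : V →ₗ[ℝ] H} (hA : ∀ X, X ≠ 0 → ‖A X‖ < ‖X‖) {b : H} {Y : V}
    (hY : IsLocalMin (fun X ↦ quadEnvelope 2 f X + ((‖A X - b‖ ^ 2 : ℝ) : EReal)) Y) :
    Y ∈ C := by
  obtain ⟨Z, hZ⟩ := exists_forall_infDist_sq_sub_le h0 hc hcoer Y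
  have hYM := mem_convexHull_nearest hC ⟨0, h0⟩ hZ
  set M := {W | W ∈ C ∧ ‖Z - W‖ = infDist Z C} with hM
  suffices h : Y ∈ (convexHull ℝ M).extremePoints ℝ from (extremePoints_convexHull_subset h).1
  -- `r` is at most the functional at `Y` and at least the functional on the hull, so `Y` is also a
  -- local minimizer of `r` on the hull.
  let r : V → ℝ := fun X ↦ infDist Z C ^ 2 - ‖Z - X‖ ^ 2 + ‖A X - b‖ ^ 2
  have hr : ∀ᶠ X in 𝓝 Y, X ∈ convexHull ℝ M → r Y ≤ r X := by
    filter_upwards [hY] with X hX hXM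
    have h1 : ((r Y : ℝ) : EReal) ≤ quadEnvelope 2 f Y + ((‖A Y - b‖ ^ 2 : ℝ) : EReal) := by
      simp only [r]
      rw [EReal.coe_add]
      exact add_le_add_left (le_quadEnvelope_indicator hf hC ⟨0, h0⟩ Z Y) _
    have h2 : quadEnvelope 2 f X + ((‖A X - b‖ ^ 2 : ℝ) : EReal) ≤ ((r X : ℝ) : EReal) := by
      simp only [r]
      rw [EReal.coe_add]
      exact add_le_add_left (quadEnvelope_indicator_le hf hC ⟨0, h0⟩
        (infDist_sq_sub_le_of_mem_convexHull (fun W hW ↦ hW) hXM)) _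
    exact EReal.coe_le_coe_iff.1 (h1.trans (hX.trans h2))
  rw [mem_extremePoints]
  refine ⟨hYM, fun x hx y hy hxy ↦ ?_⟩
  obtain ⟨s, t, hs, ht, hst, rfl⟩ := hxy
  by_cases hne : x = y
  · subst hne
    simp [← add_smul, hst]
  exfalso
  set Y := s • x + t • y with hYdef
  have hlim : ∀ k : ℝ, Tendsto (fun τ : ℝ ↦ Y + (k * τ) • (x - y)) (𝓝[>] 0) (𝓝 Y) := by
    intro k
    have : Continuous fun τ : ℝ ↦ Y + (k * τ) • (x - y) := by fun_prop
    have h := this.tendsto 0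
    simp only [mul_zero, zero_smul, add_zero] at h
    exact h.mono_left nhdsWithin_le_nhds
  have hsmall : ∀ᶠ τ : ℝ in 𝓝[>] 0, τ < min s t :=
    nhdsWithin_le_nhds (Iio_mem_nhds (lt_min hs ht))
  -- If `Y` were interior to the segment, small steps both ways would stay in the hull, and strict
  -- concavity would put `r Y` above the average of the two values.
  obtain ⟨τ, h1, h2, hτ, hτ0⟩ := (((hlim 1).eventually hr).and (((hlim (-1)).eventually hr).and
    (hsmall.and self_mem_nhdsWithin))).exists
  have hτ0 : 0 < τ := hτ0
  have hτs := hτ.trans_le (min_le_left s t)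
  have hτt := hτ.trans_le (min_le_right s t)
  have hpt : ∀ k : ℝ, |k| ≤ τ → Y + k • (x - y) ∈ convexHull ℝ M := by
    intro k hk
    have hk := abs_le.1 hk
    have : Y + k • (x - y) = (s + k) • x + (t - k) • y := by rw [hYdef]; module
    rw [this]
    exact convex_convexHull ℝ M hx hy (by linarith) (by linarith) (by linarith)
  have h1 := h1 (hpt _ (by simp [abs_of_pos hτ0]))
  have h2 := h2 (hpt _ (by simp [abs_of_pos hτ0]))
  set P := Y + (1 * τ) • (x - y) with hP
  set Q := Y + (-1 * τ) • (x - y) with hQ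
  have hmid : Y = (1 / 2 : ℝ) • P + (1 / 2 : ℝ) • Q := by rw [hP, hQ]; module
  have hPQ : P ≠ Q := by
    intro h
    have : (2 * τ) • (x - y) = 0 := by
      have h' : (2 * τ) • (x - y) = P - Q := by rw [hP, hQ]; module
      rw [h', h, sub_self]
    rcases smul_eq_zero.1 this with h | h
    · linarith
    · exact hne (sub_eq_zero.1 h)
  have hrY : r Y = 1 / 2 * r P + 1 / 2 * r Q + 1 / 4 * (‖P - Q‖ ^ 2 - ‖A (P - Q)‖ ^ 2) := by
    simp only [r]
    rw [hmid, norm_sub_sq_convex_combination P Q Z (by norm_num),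
      norm_map_sub_sq_convex_combination A b P Q (by norm_num)]
    ring
  have := pow_lt_pow_left₀ (hA _ (sub_ne_zero.2 hPQ)) (norm_nonneg _) two_ne_zero
  linarith

/-- First order condition at a local minimizer of the regularized functional that lies in `C`. -/
theorem first_order_of_isLocalMin (hf : IsIndicator f C) (hC : IsClosed C)
    {A : V →ₗ[ℝ] H} (hA : ∀ X, ‖A X‖ ≤ ‖X‖) {b : H} {Y : V} (hYC : Y ∈ C)
    (hY : IsLocalMin (fun X ↦ quadEnvelope 2 f X + ((‖A X - b‖ ^ 2 : ℝ) : EReal)) Y)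
    {W : V} (hW : W ∈ C) :
    0 ≤ ‖W - Y‖ ^ 2 + 2 * inner ℝ (A Y - b) (A (W - Y)) := by
  have hlim : Tendsto (fun s : ℝ ↦ (1 - s) • Y + s • W) (𝓝[>] 0) (𝓝 Y) := by
    have : Continuous fun s : ℝ ↦ (1 - s) • Y + s • W := by fun_prop
    have h := this.tendsto 0
    simp only [sub_zero, one_smul, zero_smul, add_zero] at h
    exact h.mono_left nhdsWithin_le_nhds
  have hsmall : ∀ᶠ s : ℝ in 𝓝[>] 0, s < 1 := nhdsWithin_le_nhds (Iio_mem_nhds one_pos)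
  obtain ⟨s, hs, hs1, hs0⟩ := ((hlim.eventually hY).and
    (hsmall.and self_mem_nhdsWithin)).exists
  have hs0 : 0 < s := hs0
  -- Each term of the supremum is a convex combination of its values at `Y` and `W`, both
  -- nonpositive since these lie in `C`, plus the defect `(1 - s) s ‖Y - W‖²`.
  have henv : quadEnvelope 2 f ((1 - s) • Y + s • W)
      ≤ (((1 - s) * s * ‖Y - W‖ ^ 2 : ℝ) : EReal) := by
    refine quadEnvelope_indicator_le hf hC ⟨Y, hYC⟩ fun Z ↦ ?_
    rw [norm_sub_sq_convex_combination Y W Z (by ring)]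
    have h1 := infDist_sq_sub_norm_sq_nonpos hYC Z
    have h2 := infDist_sq_sub_norm_sq_nonpos hW Z
    nlinarith [mul_le_mul_of_nonneg_left h1 (sub_nonneg.2 hs1.le),
      mul_le_mul_of_nonneg_left h2 hs0.le]
  beta_reduce at hs
  rw [quadEnvelope_indicator_of_mem hf hC ⟨Y, hYC⟩ hYC, zero_add] at hs
  have h := hs.trans (add_le_add_left henv _)
  rw [← EReal.coe_add, EReal.coe_le_coe_iff] at h
  have e : A ((1 - s) • Y + s • W) - b = (A Y - b) + s • A (W - Y) := by
    rw [map_add, map_smul, map_smul, map_sub]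
    module
  rw [e, norm_add_sq_real, real_inner_smul_right, norm_smul, mul_pow, Real.norm_eq_abs, sq_abs,
    norm_sub_rev Y W] at h
  have h1 : ‖A (W - Y)‖ ^ 2 ≤ ‖W - Y‖ ^ 2 := pow_le_pow_left₀ (norm_nonneg _) (hA _) 2
  -- The `s²` terms add up to `s²(‖A(W - Y)‖² - ‖W - Y‖²) ≤ 0`, so a single small `s` suffices and
  -- no limit is taken.
  have h2 : 0 ≤ s * (‖W - Y‖ ^ 2 + 2 * inner ℝ (A Y - b) (A (W - Y))) := by
    nlinarith [mul_le_mul_of_nonneg_left h1 (sq_nonneg s)]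
  exact nonneg_of_mul_nonneg_right h2 hs0

end Minimizers

end LowRank

/-! ### Frobenius inner product, rank and row projections -/

namespace LowRank

open Matrix

section Frobenius

variable {𝕜 : Type*} [RCLike 𝕜] {m n p : ℕ}

theorem frobenius_norm_sq (X : Matrix (Fin m) (Fin n) 𝕜) :
    ‖X‖ ^ 2 = ∑ i, ∑ j, ‖X i j‖ ^ 2 := by
  rw [frobenius_norm_def, ← Real.sqrt_eq_rpow, Real.sq_sqrt (by positivity)]
  simp

theorem re_trace_conjTranspose_mul_self (X : Matrix (Fin m) (Fin n) 𝕜) :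
    RCLike.re (Xᴴ * X).trace = ‖X‖ ^ 2 := by
  rw [frobenius_norm_sq, Finset.sum_comm]
  simp only [trace, diag_apply, mul_apply, conjTranspose_apply, map_sum]
  refine Finset.sum_congr rfl fun j _ ↦ Finset.sum_congr rfl fun i _ ↦ ?_
  rw [RCLike.star_def, RCLike.conj_mul]
  norm_cast

/-- The real inner product `Re tr(Xᴴ Y)` inducing the Frobenius norm. -/
@[reducible]
noncomputable def frobeniusInnerProductSpace :
    InnerProductSpace ℝ (Matrix (Fin m) (Fin n) 𝕜) :=
  -- Reusing the existing normed structure keeps the norm of the inner product space the Frobenius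
  -- norm by definition.
  { (Matrix.frobeniusNormedSpace : NormedSpace ℝ (Matrix (Fin m) (Fin n) 𝕜)) with
    inner := fun X Y ↦ RCLike.re (Xᴴ * Y).trace
    norm_sq_eq_re_inner := fun X ↦ by
      simpa using (re_trace_conjTranspose_mul_self X).symm
    conj_inner_symm := fun X Y ↦ by
      simp only [conj_trivial]
      rw [← RCLike.conj_re (Yᴴ * X).trace, ← RCLike.star_def, ← trace_conjTranspose,
        conjTranspose_mul, conjTranspose_conjTranspose]
    add_left := fun X Y Z ↦ by
      simp [Matrix.add_mul]
    smul_left := fun X Y r ↦ by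
      simp [RCLike.smul_re] }

attribute [local instance] frobeniusInnerProductSpace

theorem frobenius_inner_def (X Y : Matrix (Fin m) (Fin n) 𝕜) :
    inner ℝ X Y = RCLike.re (Xᴴ * Y).trace := rfl

theorem frobenius_norm_sq_eq_sum_col (X : Matrix (Fin m) (Fin n) 𝕜) :
    ‖X‖ ^ 2 = ∑ j, ‖WithLp.toLp 2 (X.col j)‖ ^ 2 := by
  rw [frobenius_norm_sq, Finset.sum_comm]
  simp [EuclideanSpace.norm_sq_eq]

theorem norm_toEuclideanLin_apply_le (X : Matrix (Fin m) (Fin n) 𝕜)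
    (v : EuclideanSpace 𝕜 (Fin n)) : ‖toEuclideanLin X v‖ ≤ ‖X‖ * ‖v‖ := by
  have h := frobenius_norm_mul X (replicateCol Unit v.ofLp)
  rw [← replicateCol_mulVec, frobenius_norm_replicateCol, frobenius_norm_replicateCol] at h
  exact h

/-- A lower bound of `X` on a subspace extends columnwise to matrices with columns there. -/
theorem mul_norm_le_norm_mul {X : Matrix (Fin m) (Fin n) 𝕜} {B : Matrix (Fin n) (Fin p) 𝕜}
    {α : ℝ} (hα : 0 ≤ α)
    (h : ∀ j, α * ‖WithLp.toLp 2 (B.col j)‖ ≤ ‖toEuclideanLin X (WithLp.toLp 2 (B.col j))‖) :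
    α * ‖B‖ ≤ ‖X * B‖ := by
  refine le_of_sq_le_sq ?_ (norm_nonneg _)
  rw [mul_pow, frobenius_norm_sq_eq_sum_col, frobenius_norm_sq_eq_sum_col, Finset.mul_sum]
  refine Finset.sum_le_sum fun j _ ↦ ?_
  rw [← mul_pow]
  exact pow_le_pow_left₀ (by positivity) (h j) 2

theorem rank_eq_finrank_range_toEuclideanLin (X : Matrix (Fin m) (Fin n) 𝕜) :
    X.rank = Module.finrank 𝕜 (LinearMap.range (toEuclideanLin X)) := by
  rw [rank_eq_finrank_range_toLin X (PiLp.basisFun 2 𝕜 (Fin m)) (PiLp.basisFun 2 𝕜 (Fin n)),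
    ← toLpLin_eq_toLin 2 2]

/-- Rank is lower semicontinuous: the complement, where the rank is at least `K + 1`, is open. -/
theorem isClosed_setOf_rank_le (K : ℕ) :
    IsClosed {X : Matrix (Fin m) (Fin n) 𝕜 | X.rank ≤ K} := by
  let Φ : Matrix (Fin m) (Fin n) 𝕜 →ₗ[𝕜]
      EuclideanSpace 𝕜 (Fin n) →L[𝕜] EuclideanSpace 𝕜 (Fin m) :=
    LinearMap.toContinuousLinearMap.toLinearMap ∘ₗ toEuclideanLin.toLinearMap
  have hΦ : Continuous Φ := Φ.continuous_of_finiteDimensional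
  rw [← isOpen_compl_iff]
  convert (isOpen_setOfPred_nat_le_rank (K + 1)).preimage hΦ using 1
  ext X
  simp only [Set.mem_compl_iff, Set.mem_ofPred_eq, Set.mem_preimage, not_le]
  rw [rank_eq_finrank_range_toEuclideanLin, ← Nat.succ_le_iff, LinearMap.rank,
    ← Module.finrank_eq_rank, Nat.cast_le]
  rfl

theorem rank_sub_le (X Y : Matrix (Fin m) (Fin n) 𝕜) : (X - Y).rank ≤ X.rank + Y.rank := by
  simp only [rank_eq_finrank_range_toEuclideanLin]
  refine le_trans ?_ (Submodule.finrank_add_le_finrank_add_finrank _ _)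
  refine Submodule.finrank_mono ?_
  rintro _ ⟨v, rfl⟩
  rw [map_sub, LinearMap.sub_apply]
  exact Submodule.sub_mem _ (Submodule.mem_sup_left ⟨v, rfl⟩) (Submodule.mem_sup_right ⟨v, rfl⟩)

/-- The matrix of the orthogonal projection onto the row space of `X`, that is, onto the
orthogonal complement of its kernel. -/
noncomputable def rowProj (X : Matrix (Fin m) (Fin n) 𝕜) : Matrix (Fin n) (Fin n) 𝕜 :=
  toEuclideanLin.symm
    ((LinearMap.ker (toEuclideanLin X))ᗮ.starProjection : EuclideanSpace 𝕜 (Fin n) →ₗ[𝕜] _)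

variable (X : Matrix (Fin m) (Fin n) 𝕜)

theorem toEuclideanLin_rowProj_apply (v : EuclideanSpace 𝕜 (Fin n)) :
    toEuclideanLin (rowProj X) v = (LinearMap.ker (toEuclideanLin X))ᗮ.starProjection v := by
  simp [rowProj]

theorem toEuclideanLin_mul_apply {Y : Matrix (Fin n) (Fin p) 𝕜} (v : EuclideanSpace 𝕜 (Fin p)) :
    toEuclideanLin (X * Y) v = toEuclideanLin X (toEuclideanLin Y v) := by
  simp [toLpLin_apply]

theorem rowProj_conjTranspose : (rowProj X)ᴴ = rowProj X := by
  apply toEuclideanLin.injective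
  rw [toEuclideanLin_conjTranspose_eq_adjoint]
  refine ((LinearMap.eq_adjoint_iff _ _).2 fun x y ↦ ?_).symm
  rw [toEuclideanLin_rowProj_apply, toEuclideanLin_rowProj_apply]
  exact Submodule.inner_starProjection_left_eq_right _ _ _

theorem rowProj_mul_self : rowProj X * rowProj X = rowProj X := by
  apply toEuclideanLin.injective
  ext1 v
  rw [toEuclideanLin_mul_apply, toEuclideanLin_rowProj_apply, toEuclideanLin_rowProj_apply,
    Submodule.starProjection_eq_self_iff]
  exact Submodule.starProjection_apply_mem _ _

theorem mul_rowProj : X * rowProj X = X := by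
  apply toEuclideanLin.injective
  ext1 v
  rw [toEuclideanLin_mul_apply, toEuclideanLin_rowProj_apply]
  have h := Submodule.sub_starProjection_mem_orthogonal
    (K := (LinearMap.ker (toEuclideanLin X))ᗮ) v
  rw [Submodule.orthogonal_orthogonal, LinearMap.mem_ker, map_sub, sub_eq_zero] at h
  exact h.symm

theorem mul_rowProj_eq_zero {E : Matrix (Fin p) (Fin n) 𝕜} (h : E * Xᴴ = 0) :
    E * rowProj X = 0 := by
  rw [← conjTranspose_eq_zero, conjTranspose_mul, rowProj_conjTranspose]
  have h' : X * Eᴴ = 0 := by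
    rw [← conjTranspose_eq_zero, conjTranspose_mul, conjTranspose_conjTranspose, h]
  apply toEuclideanLin.injective
  ext1 v
  rw [toEuclideanLin_mul_apply, toEuclideanLin_rowProj_apply, map_zero, LinearMap.zero_apply,
    Submodule.starProjection_apply_eq_zero_iff, Submodule.orthogonal_orthogonal,
    LinearMap.mem_ker, ← toEuclideanLin_mul_apply, h', map_zero, LinearMap.zero_apply]

theorem finrank_ker_orthogonal :
    Module.finrank 𝕜 (LinearMap.ker (toEuclideanLin X))ᗮ = X.rank := by
  have h1 := Submodule.finrank_add_finrank_orthogonal (LinearMap.ker (toEuclideanLin X))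
  have h2 := LinearMap.finrank_range_add_finrank_ker (toEuclideanLin X)
  rw [rank_eq_finrank_range_toEuclideanLin]
  omega

/-- The trace of a projection is the dimension of its range. This turns the rank inequality between
`W` and `X` into a comparison of Frobenius norms. -/
theorem trace_rowProj : (rowProj X).trace = (X.rank : 𝕜) := by
  set S := (LinearMap.ker (toEuclideanLin X))ᗮ
  have hp : LinearMap.IsProj S (toEuclideanLin (rowProj X)) :=
    ⟨fun v ↦ by
      rw [toEuclideanLin_rowProj_apply]
      exact Submodule.starProjection_apply_mem _ _,
    fun v hv ↦ by
      rw [toEuclideanLin_rowProj_apply]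
      exact Submodule.starProjection_eq_self_iff.2 hv⟩
  have h := hp.trace
  have h' := trace_toLin_eq (rowProj X) (PiLp.basisFun 2 𝕜 (Fin n))
  rw [← h', ← toLpLin_eq_toLin 2 2, h, ← finrank_ker_orthogonal]

/-- Pythagoras for right multiplication by an orthogonal projection. -/
theorem norm_sq_mul_add_norm_sq_mul_one_sub {Q : Matrix (Fin n) (Fin n) 𝕜} (hQ : Qᴴ = Q)
    (hQQ : Q * Q = Q) : ‖X * Q‖ ^ 2 + ‖X * (1 - Q)‖ ^ 2 = ‖X‖ ^ 2 := by
  have e : X = X * Q + X * (1 - Q) := by rw [← Matrix.mul_add]; simp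
  have h : inner ℝ (X * Q) (X * (1 - Q)) = 0 := by
    rw [frobenius_inner_def, conjTranspose_mul, hQ, Matrix.mul_assoc, trace_mul_comm,
      ← Matrix.mul_assoc, Matrix.mul_assoc, Matrix.sub_mul, Matrix.one_mul, hQQ, sub_self]
    simp
  conv_rhs => rw [e, norm_add_sq_real, h]
  ring

end Frobenius

end LowRank

/-! ### Lower bounds from singular values -/

namespace LinearMap

variable {𝕜 : Type*} [RCLike 𝕜]
  {E : Type*} [NormedAddCommGroup E] [InnerProductSpace 𝕜 E] [FiniteDimensional 𝕜 E]
  {F : Type*} [NormedAddCommGroup F] [InnerProductSpace 𝕜 F] [FiniteDimensional 𝕜 F]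

/-- On the span of the first `j + 1` right singular vectors, `T` is bounded below by the singular
value with index `j`. -/
theorem exists_submodule_singularValues_mul_norm_le (T : E →ₗ[𝕜] F) {j : ℕ}
    (hj : j < Module.finrank 𝕜 E) :
    ∃ S : Submodule 𝕜 E, Module.finrank 𝕜 S = j + 1 ∧
      ∀ v ∈ S, T.singularValues j * ‖v‖ ≤ ‖T v‖ := by
  set hT := T.isSymmetric_adjoint_comp_self
  set b := hT.eigenvectorBasis rfl
  let ι : Fin (j + 1) → Fin (Module.finrank 𝕜 E) := Fin.castLE hj
  have hι : Function.Injective ι := Fin.castLE_injective hj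
  refine ⟨Submodule.span 𝕜 (Set.range (b ∘ ι)), ?_, fun v hv ↦ ?_⟩
  · rw [finrank_span_eq_card (b.orthonormal.linearIndependent.comp ι hι), Fintype.card_fin]
  have hzero : ∀ i, j < i.val → inner 𝕜 (b i) v = 0 := by
    intro i hi
    have hle : Submodule.span 𝕜 (Set.range (b ∘ ι)) ≤ (Submodule.span 𝕜 {b i})ᗮ := by
      rw [Submodule.span_le]
      rintro _ ⟨k, rfl⟩
      refine Submodule.mem_orthogonal_singleton_iff_inner_right.2 (b.orthonormal.2 ?_)
      rintro rfl
      have := k.2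
      simp only [ι, Fin.val_castLE] at hi
      omega
    exact Submodule.mem_orthogonal_singleton_iff_inner_right.1 (hle hv)
  refine le_of_sq_le_sq ?_ (norm_nonneg _)
  -- Expansion of `⟨v, T*T v⟩` in the eigenbasis. The eigenvalues are the squared singular values in
  -- decreasing order, and only indices up to `j` contribute for `v` in the span.
  have hTv : ‖T v‖ ^ 2 = ∑ i, hT.eigenvalues rfl i * ‖inner 𝕜 (b i) v‖ ^ 2 := by
    rw [← inner_self_eq_norm_sq (𝕜 := 𝕜), ← LinearMap.adjoint_inner_right,
      ← LinearMap.comp_apply, ← b.sum_inner_mul_inner, map_sum]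
    refine Finset.sum_congr rfl fun i _ ↦ ?_
    rw [← b.repr_apply_apply (adjoint T ∘ₗ T <| v) i, hT.eigenvectorBasis_apply_self_apply,
      b.repr_apply_apply, ← inner_conj_symm v (b i), mul_left_comm, RCLike.conj_mul]
    norm_cast
  rw [hTv, mul_pow, ← b.sum_sq_norm_inner_right v, Finset.mul_sum]
  refine Finset.sum_le_sum fun i _ ↦ ?_
  rcases lt_or_ge j i.val with hi | hi
  · simp [hzero i hi]
  · refine mul_le_mul_of_nonneg_right ?_ (sq_nonneg _)
    rw [← T.sq_singularValues_fin rfl i]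
    exact pow_le_pow_left₀ (T.singularValues_nonneg j) (T.singularValues_antitone hi) 2

end LinearMap

/-! ### Eckart–Young and the geometry of bounded rank -/

namespace LowRank

open Matrix

attribute [local instance] frobeniusInnerProductSpace

section RankApproximation

variable {𝕜 : Type*} [RCLike 𝕜] {m n : ℕ}

/-- If `X` of rank at most `K` is bounded below by `α > 0` on some `K`-dimensional subspace, then
it has rank `K` and is bounded below by `α` on its row space. -/
theorem rank_eq_and_bound_on_row_space {X : Matrix (Fin m) (Fin n) 𝕜} {K : ℕ} {α : ℝ}
    (hα : 0 < α) (hX : X.rank ≤ K) {S : Submodule 𝕜 (EuclideanSpace 𝕜 (Fin n))}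
    (hS : Module.finrank 𝕜 S = K) (hSX : ∀ v ∈ S, α * ‖v‖ ≤ ‖toEuclideanLin X v‖) :
    X.rank = K ∧ ∀ v ∈ (LinearMap.ker (toEuclideanLin X))ᗮ, α * ‖v‖ ≤ ‖toEuclideanLin X v‖ := by
  set T := toEuclideanLin X
  set U := (LinearMap.ker T)ᗮ
  -- Projecting `S` to the row space only removes kernel components, so `T` is unchanged and norms
  -- do not grow. The lower bound makes `g` injective, and equal dimensions make it onto.
  let g : S →ₗ[𝕜] U := U.orthogonalProjectionOnto.toLinearMap ∘ₗ S.subtype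
  have hgval : ∀ s : S, ((g s : U) : EuclideanSpace 𝕜 (Fin n)) = U.starProjection s := fun s ↦ rfl
  have hTg : ∀ s : S, T (g s) = T s := by
    intro s
    have h := Submodule.sub_starProjection_mem_orthogonal (K := U) (s : EuclideanSpace 𝕜 (Fin n))
    rw [Submodule.orthogonal_orthogonal, LinearMap.mem_ker, map_sub, sub_eq_zero] at h
    rw [hgval, h]
  have hginj : Function.Injective g := by
    rw [injective_iff_map_eq_zero]
    intro s hs
    have h1 := hSX s s.2
    rw [← hTg s, hs] at h1
    simp only [ZeroMemClass.coe_zero, map_zero, norm_zero] at h1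
    have h2 : ‖(s : EuclideanSpace 𝕜 (Fin n))‖ = 0 :=
      le_antisymm (nonpos_of_mul_nonpos_right h1 hα) (norm_nonneg _)
    exact Subtype.ext (norm_eq_zero.1 h2)
  have hfr := LinearMap.finrank_le_finrank_of_injective hginj
  rw [hS, finrank_ker_orthogonal] at hfr
  have hrank : X.rank = K := le_antisymm hX hfr
  refine ⟨hrank, fun v hv ↦ ?_⟩
  have hfin : Module.finrank 𝕜 S = Module.finrank 𝕜 U := by
    rw [hS, finrank_ker_orthogonal, hrank]
  obtain ⟨s, hs⟩ := (LinearMap.injective_iff_surjective_of_finrank_eq_finrank hfin).1 hginj ⟨v, hv⟩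
  have hsv : U.starProjection (s : EuclideanSpace 𝕜 (Fin n)) = v := by rw [← hgval, hs]
  have h1 := hTg s
  rw [hs] at h1
  simp only at h1
  rw [h1]
  refine le_trans ?_ (hSX s s.2)
  refine mul_le_mul_of_nonneg_left ?_ hα.le
  rw [← hsv]
  exact Submodule.norm_starProjection_apply_le _ _

/-- A sharp Eckart–Young type inequality: if `E` is orthogonal to the row and column spaces of `X`
and `τ ‖E‖` is at most the smallest nonzero singular value of `X`, then `X` is a best approximation
of `X + τ E` of its rank. -/
theorem two_mul_inner_le_of_rank_le {X E W : Matrix (Fin m) (Fin n) 𝕜} {α τ : ℝ} (hα : 0 ≤ α)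
    (hXα : ∀ v ∈ (LinearMap.ker (toEuclideanLin X))ᗮ, α * ‖v‖ ≤ ‖toEuclideanLin X v‖)
    (hXE : Xᴴ * E = 0) (hEX : E * Xᴴ = 0) (hτ : 0 ≤ τ) (hτE : τ * ‖E‖ ≤ α)
    (hW : W.rank ≤ X.rank) :
    2 * τ * inner ℝ E (W - X) ≤ ‖W - X‖ ^ 2 := by
  set Q := rowProj W with hQdef
  set R := rowProj X with hRdef
  have hQ : Qᴴ = Q := rowProj_conjTranspose W
  have hR : Rᴴ = R := rowProj_conjTranspose X
  have hQQ : Q * Q = Q := rowProj_mul_self W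
  have hRR : R * R = R := rowProj_mul_self X
  have hXR : X * R = X := mul_rowProj X
  have hER : E * R = 0 := mul_rowProj_eq_zero X hEX
  -- comparison of the two projections
  have hproj : ‖(1 - R) * Q‖ ^ 2 ≤ ‖R * (1 - Q)‖ ^ 2 := by
    have h1 : ((1 - R) * Q)ᴴ * ((1 - R) * Q) = Q * Q - Q * R * Q := by
      rw [conjTranspose_mul, conjTranspose_sub, hQ, hR, conjTranspose_one]
      have : Q * (1 - R) * ((1 - R) * Q) = Q * (1 - R - R + R * R) * Q := by noncomm_ring
      rw [this, hRR]
      noncomm_ring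
    have h2 : (R * (1 - Q))ᴴ * (R * (1 - Q)) = R * R - R * R * Q - Q * (R * R) + Q * (R * R) * Q := by
      rw [conjTranspose_mul, conjTranspose_sub, hQ, hR, conjTranspose_one]
      noncomm_ring
    -- The two squares are `rank W - Re tr(RQ)` and `rank X - Re tr(RQ)`.
    rw [← re_trace_conjTranspose_mul_self, ← re_trace_conjTranspose_mul_self, h1, h2, hRR, hQQ,
      trace_add, trace_sub, trace_sub, trace_sub, trace_mul_cycle Q R Q, hQQ, trace_mul_comm R Q,
      trace_rowProj, trace_rowProj]
    have h3 : (W.rank : ℝ) ≤ X.rank := by exact_mod_cast hW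
    simp only [map_sub, map_add, RCLike.natCast_re]
    linarith
  -- Since `E R = 0` and `X R = X`, only `(1 - R) Q` and `R (1 - Q)` matter: what `E` gains on the
  -- row space of `W` is paid for by what `X` loses off it.
  have hEQ : τ * ‖E * Q‖ ≤ ‖X * (1 - Q)‖ := by
    have h1 : E * Q = E * ((1 - R) * Q) := by
      rw [← Matrix.mul_assoc, Matrix.mul_sub, hER, Matrix.mul_one, sub_zero]
    have h2 : X * (1 - Q) = X * (R * (1 - Q)) := by rw [← Matrix.mul_assoc, hXR]
    have h3 : α * ‖R * (1 - Q)‖ ≤ ‖X * (R * (1 - Q))‖ := by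
      refine mul_norm_le_norm_mul hα fun j ↦ hXα _ ?_
      have : WithLp.toLp 2 ((R * (1 - Q)).col j)
          = toEuclideanLin R (WithLp.toLp 2 ((1 - Q).col j)) := by
        rw [toLpLin_apply]
        rfl
      rw [this, hRdef, toEuclideanLin_rowProj_apply]
      exact Submodule.starProjection_apply_mem _ _
    have h4 : ‖(1 - R) * Q‖ ≤ ‖R * (1 - Q)‖ := le_of_sq_le_sq hproj (norm_nonneg _)
    rw [h1, h2]
    calc τ * ‖E * ((1 - R) * Q)‖ ≤ τ * (‖E‖ * ‖(1 - R) * Q‖) :=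
          mul_le_mul_of_nonneg_left (frobenius_norm_mul _ _) hτ
      _ = (τ * ‖E‖) * ‖(1 - R) * Q‖ := by ring
      _ ≤ α * ‖R * (1 - Q)‖ := mul_le_mul hτE h4 (norm_nonneg _) hα
      _ ≤ _ := h3
  have hXEi : inner ℝ X E = 0 := by simp [frobenius_inner_def, hXE]
  have horth : inner ℝ (X * (1 - Q)) (E * (1 - Q)) = 0 := by
    rw [frobenius_inner_def, conjTranspose_mul, Matrix.mul_assoc, ← Matrix.mul_assoc Xᴴ, hXE]
    simp
  -- This is `d(X + τE, W) ≥ d(X + τE, X)`. Only the part multiplied by `1 - Q`, where `W` vanishes,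
  -- is kept; there `X` and `E` are orthogonal.
  have hkey : τ ^ 2 * ‖E‖ ^ 2 ≤ ‖(X - W) + τ • E‖ ^ 2 := by
    have h1 := norm_sq_mul_add_norm_sq_mul_one_sub ((X - W) + τ • E) hQ hQQ
    have h2 : ((X - W) + τ • E) * (1 - Q) = X * (1 - Q) + τ • (E * (1 - Q)) := by
      have hWQ : W * (1 - Q) = 0 := by
        rw [Matrix.mul_sub, Matrix.mul_one, hQdef, mul_rowProj, sub_self]
      rw [Matrix.add_mul, Matrix.sub_mul, hWQ, sub_zero, Matrix.smul_mul]
    rw [h2, norm_add_sq_real, real_inner_smul_right, horth, norm_smul, mul_pow, Real.norm_eq_abs,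
      sq_abs] at h1
    have h3 := norm_sq_mul_add_norm_sq_mul_one_sub E hQ hQQ
    have h4 := pow_le_pow_left₀ (by positivity) hEQ 2
    rw [mul_pow] at h4
    nlinarith [sq_nonneg ‖((X - W) + τ • E) * Q‖]
  rw [norm_add_sq_real, real_inner_smul_right, norm_smul, mul_pow, Real.norm_eq_abs, sq_abs,
    norm_sub_rev, ← neg_sub W X, inner_neg_left, real_inner_comm] at hkey
  linarith

theorem nonpos_of_forall_mul_le_sq_mul {a c : ℝ} (h : ∀ s : ℝ, 2 * (s * a) ≤ s ^ 2 * c) : a ≤ 0 := by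
  by_contra! ha
  have hc : 0 < |c| + 1 := by positivity
  -- With this `s` the quadratic term is at most `s a`, half the linear one.
  have h1 := h (a / (|c| + 1))
  have h2 : (a / (|c| + 1)) ^ 2 * c ≤ (a / (|c| + 1)) * a := by
    rw [pow_two, mul_assoc]
    refine mul_le_mul_of_nonneg_left ?_ (by positivity)
    rw [div_mul_eq_mul_div, div_le_iff₀ hc]
    nlinarith [le_abs_self c]
  have h3 : 0 < a / (|c| + 1) * a := by positivity
  linarith

/-- The normal vector at a best approximation of bounded rank is orthogonal to the column and row
spaces. -/
theorem mul_eq_zero_of_forall_two_mul_inner_le {X E : Matrix (Fin m) (Fin n) 𝕜}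
    (h : ∀ W : Matrix (Fin m) (Fin n) 𝕜, W.rank ≤ X.rank → 2 * inner ℝ E (W - X) ≤ ‖W - X‖ ^ 2) :
    Xᴴ * E = 0 ∧ E * Xᴴ = 0 := by
  constructor
  · have h1 : ‖Xᴴ * E‖ ^ 2 ≤ 0 := by
      refine nonpos_of_forall_mul_le_sq_mul (c := ‖X * (Xᴴ * E)‖ ^ 2) fun s ↦ ?_
      -- Multiplying `X` by a matrix cannot raise the rank, so this is a competitor for every `s`;
      -- its first order term is `s‖Xᴴ E‖²`.
      have h2 := h (X * (1 + s • (Xᴴ * E))) (rank_mul_le_left _ _)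
      have e : X * (1 + s • (Xᴴ * E)) - X = s • (X * (Xᴴ * E)) := by
        rw [Matrix.mul_add, Matrix.mul_one, add_sub_cancel_left, Matrix.mul_smul]
      rw [e, real_inner_smul_right, norm_smul, mul_pow, Real.norm_eq_abs, sq_abs,
        frobenius_inner_def, ← Matrix.mul_assoc Eᴴ] at h2
      rw [← re_trace_conjTranspose_mul_self, conjTranspose_mul, conjTranspose_conjTranspose]
      exact h2
    exact norm_eq_zero.1 (pow_eq_zero_iff two_ne_zero |>.1 (le_antisymm h1 (sq_nonneg _)))
  · have h1 : ‖E * Xᴴ‖ ^ 2 ≤ 0 := by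
      refine nonpos_of_forall_mul_le_sq_mul (c := ‖E * Xᴴ * X‖ ^ 2) fun s ↦ ?_
      have h2 := h ((1 + s • (E * Xᴴ)) * X) (rank_mul_le_right _ _)
      have e : (1 + s • (E * Xᴴ)) * X - X = s • (E * Xᴴ * X) := by
        rw [Matrix.add_mul, Matrix.one_mul, add_sub_cancel_left, Matrix.smul_mul]
      rw [e, real_inner_smul_right, norm_smul, mul_pow, Real.norm_eq_abs, sq_abs,
        frobenius_inner_def, ← Matrix.mul_assoc Eᴴ, trace_mul_comm, ← Matrix.mul_assoc] at h2
      rw [← re_trace_conjTranspose_mul_self, conjTranspose_mul, conjTranspose_conjTranspose]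
      exact h2
    exact norm_eq_zero.1 (pow_eq_zero_iff two_ne_zero |>.1 (le_antisymm h1 (sq_nonneg _)))

/-- Keeping a single entry of `Z` gives a matrix of rank at most one at squared distance `‖Z‖² - ‖Z
i j‖²`; averaging over the entries gives the bound. It supplies the coercivity that makes the
envelope's supremum attained. -/
theorem infDist_rank_le_sq_le {K : ℕ} (hK : 1 ≤ K) (hmn : 0 < m * n) (Z : Matrix (Fin m) (Fin n) 𝕜) :
    (Metric.infDist Z {X | X.rank ≤ K}) ^ 2 ≤ (1 - 1 / (m * n : ℝ)) * ‖Z‖ ^ 2 := by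
  have hij : ∀ i j, (Metric.infDist Z {X | X.rank ≤ K}) ^ 2 ≤ ‖Z‖ ^ 2 - ‖Z i j‖ ^ 2 := by
    intro i j
    have hmem : single i j (Z i j) ∈ {X : Matrix (Fin m) (Fin n) 𝕜 | X.rank ≤ K} := by
      have h1 : single i j (Z i j) = vecMulVec (Pi.single i (Z i j)) (Pi.single j (1 : 𝕜)) := by
        ext a b
        simp [vecMulVec_apply, single_apply, Pi.single_apply, ← ite_and, eq_comm, and_comm]
      simp only [Set.mem_ofPred_eq]
      rw [h1]
      exact (rank_vecMulVec_le _ _).trans hK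
    have h1 := pow_le_pow_left₀ Metric.infDist_nonneg (Metric.infDist_le_dist_of_mem (x := Z) hmem) 2
    have h2 : ‖single i j (Z i j)‖ ^ 2 = ‖Z i j‖ ^ 2 := by
      rw [← re_trace_conjTranspose_mul_self, conjTranspose_single, single_mul_single_same,
        trace_single_eq_same, RCLike.star_def, RCLike.conj_mul]
      norm_cast
    have h3 : inner ℝ Z (single i j (Z i j)) = ‖Z i j‖ ^ 2 := by
      rw [frobenius_inner_def, trace_mul_single, conjTranspose_apply]
      simp [RCLike.conj_mul]
    rw [dist_eq_norm, norm_sub_sq_real, h2, h3] at h1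
    linarith
  have hsum := Finset.sum_le_sum fun i (_ : i ∈ Finset.univ) ↦
    Finset.sum_le_sum fun j (_ : j ∈ Finset.univ) ↦ hij i j
  simp only [Finset.sum_sub_distrib, Finset.sum_const, Finset.card_univ, Fintype.card_fin,
    nsmul_eq_mul, ← frobenius_norm_sq] at hsum
  have hN : (0 : ℝ) < m * n := by exact_mod_cast hmn
  refine le_of_mul_le_mul_left ?_ hN
  have : (m * n : ℝ) * ((1 - 1 / (m * n : ℝ)) * ‖Z‖ ^ 2) = m * (n * ‖Z‖ ^ 2) - ‖Z‖ ^ 2 := by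
    rw [← mul_assoc, mul_sub, mul_one, mul_one_div_cancel hN.ne']
    ring
  rw [this]
  linarith

end RankApproximation

end LowRank

/-! ### Best rank `K` solutions and the scaled first order condition -/

namespace LowRank

open Matrix Filter

attribute [local instance] frobeniusInnerProductSpace

section Recovery

variable {𝕜 : Type*} [RCLike 𝕜] {n₁ n₂ : ℕ}
  {H : Type*} [NormedAddCommGroup H] [InnerProductSpace ℝ H]

theorem isIndicator_rankIndicator (K : ℕ) :
    IsIndicator (rankIndicator K) {X : Matrix (Fin n₁) (Fin n₂) 𝕜 | X.rank ≤ K} :=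
  ⟨fun _ hX ↦ if_pos hX, fun _ hX ↦ if_neg hX⟩

theorem norm_map_le_opNorm (A : Matrix (Fin n₁) (Fin n₂) 𝕜 →ₗ[ℝ] H)
    (X : Matrix (Fin n₁) (Fin n₂) 𝕜) : ‖A X‖ ≤ opNorm A * ‖X‖ :=
  (LinearMap.toContinuousLinearMap A).le_opNorm X

theorem one_sub_lrip_mul_norm_sq_le (A : Matrix (Fin n₁) (Fin n₂) 𝕜 →ₗ[ℝ] H) {k : ℕ}
    {X : Matrix (Fin n₁) (Fin n₂) 𝕜} (hX : X.rank ≤ k) :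
    (1 - lrip A k) * ‖X‖ ^ 2 ≤ ‖A X‖ ^ 2 := by
  rcases eq_or_ne X 0 with rfl | h0
  · simp
  rw [← le_div_iff₀ (by have := norm_pos_iff.2 h0; positivity), lrip, sub_sub_cancel]
  refine csInf_le ⟨0, ?_⟩ ⟨X, h0, hX, rfl⟩
  rintro _ ⟨Y, -, -, rfl⟩
  positivity

/-- The lower bound makes `‖A X - b‖` coercive on the closed set of matrices of rank at most `K`,
even if `A` is not injective on all matrices. -/
theorem exists_isBestRank (A : Matrix (Fin n₁) (Fin n₂) 𝕜 →ₗ[ℝ] H) (b : H) {K : ℕ} {c : ℝ}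
    (hc : 0 < c) (hA : ∀ X : Matrix (Fin n₁) (Fin n₂) 𝕜, X.rank ≤ K → c * ‖X‖ ≤ ‖A X‖) :
    ∃ X, IsBestRank A b K X := by
  have hcont : Continuous fun X ↦ ‖A X - b‖ :=
    (A.continuous_of_finiteDimensional.sub continuous_const).norm
  obtain ⟨X, hX, hmin⟩ := hcont.continuousOn.exists_isMinOn' (isClosed_setOf_rank_le K) (x₀ := 0)
    (by simp) (by
      rw [eventually_inf_principal]
      filter_upwards [(tendsto_norm_cocompact_atTop
        (E := Matrix (Fin n₁) (Fin n₂) 𝕜)).eventually_ge_atTop (2 * ‖b‖ / c)] with X hX hXr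
      rw [div_le_iff₀ hc] at hX
      have h1 := hA X hXr
      have h2 := norm_sub_norm_le (A X) b
      rw [map_zero, zero_sub, norm_neg]
      linarith)
  exact ⟨X, hX, fun Y hY ↦ hmin hY⟩

variable [FiniteDimensional ℝ H]

/-- A best rank `K` solution with large enough smallest nonzero singular value satisfies the first
order condition with an additional factor `τ`. -/
theorem first_order_scaled {A : Matrix (Fin n₁) (Fin n₂) 𝕜 →ₗ[ℝ] H} (hA : ∀ X, ‖A X‖ ≤ ‖X‖) {b : H}
    {X X₀ : Matrix (Fin n₁) (Fin n₂) 𝕜} {K : ℕ} {τ : ℝ} (hK : 1 ≤ K) (hX₀ : X₀.rank = K)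
    (hX : X.rank ≤ K) (hτ : 0 ≤ τ)
    (hfirst : ∀ W : Matrix (Fin n₁) (Fin n₂) 𝕜, W.rank ≤ K →
      0 ≤ ‖W - X‖ ^ 2 + 2 * inner ℝ (A X - b) (A (W - X)))
    (hpos : 0 < sigma X₀ K - ‖X - X₀‖) (hτb : τ * ‖A X - b‖ ≤ sigma X₀ K - ‖X - X₀‖)
    {W : Matrix (Fin n₁) (Fin n₂) 𝕜} (hW : W.rank ≤ K) :
    0 ≤ ‖W - X‖ ^ 2 + 2 * τ * inner ℝ (A X - b) (A (W - X)) := by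
  -- Half the negative gradient of the data term at `X`; `hfirst` says that `X` is a nearest point
  -- of bounded rank to `X + E`.
  set E : Matrix (Fin n₁) (Fin n₂) 𝕜 := -(LinearMap.adjoint A (A X - b)) with hE
  have hinner : ∀ D, inner ℝ E D = -inner ℝ (A X - b) (A D) := fun D ↦ by
    rw [hE, inner_neg_left, LinearMap.adjoint_inner_left]
  have hEle : ‖E‖ ≤ ‖A X - b‖ := by
    have h1 : ‖E‖ * ‖E‖ ≤ ‖A X - b‖ * ‖E‖ := by
      rw [← real_inner_self_eq_norm_mul_norm, hinner]
      refine (neg_le_abs _).trans ((abs_real_inner_le_norm _ _).trans ?_)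
      exact mul_le_mul_of_nonneg_left (hA E) (norm_nonneg _)
    rcases (norm_nonneg E).eq_or_lt with h0 | h0
    · rw [← h0]
      exact norm_nonneg _
    · exact le_of_mul_le_mul_right h1 h0
  have hKn : K - 1 < Module.finrank 𝕜 (EuclideanSpace 𝕜 (Fin n₂)) := by
    have := X₀.rank_le_width
    rw [finrank_euclideanSpace_fin]
    omega
  -- `σ_K` has index `K - 1` in the zero-based sequence, so `S` has dimension `K - 1 + 1 = K`, using
  -- `1 ≤ K`.
  obtain ⟨S, hS, hSX₀⟩ :=
    (toEuclideanLin X₀).exists_submodule_singularValues_mul_norm_le hKn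
  -- A Weyl-type perturbation: passing from `X₀` to `X` costs at most `‖X - X₀‖` in the lower bound.
  have hSX : ∀ v ∈ S, (sigma X₀ K - ‖X - X₀‖) * ‖v‖ ≤ ‖toEuclideanLin X v‖ := by
    intro v hv
    have h1 : sigma X₀ K * ‖v‖ ≤ ‖toEuclideanLin X₀ v‖ := hSX₀ v hv
    have h2 := norm_toEuclideanLin_apply_le (X - X₀) v
    rw [map_sub, LinearMap.sub_apply] at h2
    have h3 := norm_sub_norm_le (toEuclideanLin X₀ v) (toEuclideanLin X v)
    rw [norm_sub_rev] at h3
    rw [sub_mul]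
    linarith
  obtain ⟨hrank, hXα⟩ := rank_eq_and_bound_on_row_space hpos hX (hS.trans (by omega)) hSX
  obtain ⟨hXE, hEX⟩ := mul_eq_zero_of_forall_two_mul_inner_le (X := X) (E := E) fun W hW ↦ by
    have := hfirst W (hW.trans hX)
    rw [hinner]
    linarith
  have h := two_mul_inner_le_of_rank_le hpos.le hXα hXE hEX hτ
    ((mul_le_mul_of_nonneg_left hEle hτ).trans hτb) (hW.trans hrank.ge)
  rw [hinner] at h
  linarith

end Recovery

end LowRank

/-! ### The recovery theorem -/

theorem theorem6p4 {𝕜 : Type*} [RCLike 𝕜] {n₁ n₂ : ℕ}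
    {H : Type*} [NormedAddCommGroup H] [InnerProductSpace ℝ H] [FiniteDimensional ℝ H]
    (A : Matrix (Fin n₁) (Fin n₂) 𝕜 →ₗ[ℝ] H) (b ε : H)
    (X₀ : Matrix (Fin n₁) (Fin n₂) 𝕜) (K : ℕ) (hK : 1 ≤ K)
    (hb : b = A X₀ + ε) (hA : LowRank.opNorm A < 1)
    (hδ : LowRank.lrip A (2 * K) < 1 / 2)
    (hrank : X₀.rank = K)
    (hσ : LowRank.sigma X₀ K > 5 / (1 - 2 * LowRank.lrip A (2 * K)) ^ (3 / 2 : ℝ) * ‖ε‖) :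
    ∃ X_B : Matrix (Fin n₁) (Fin n₂) 𝕜,
      (∀ X, LowRank.IsBestRank A b K X ↔ X = X_B) ∧
      (∀ X, (∀ Y, LowRank.regFunctional A b K X ≤ LowRank.regFunctional A b K Y) ↔ X = X_B) ∧
      (∀ X, IsLocalMin (LowRank.regFunctional A b K) X → X = X_B) ∧
      ‖X_B - X₀‖ ≤ 2 * ‖ε‖ / √(1 - LowRank.lrip A (2 * K)) := by
  let _ : InnerProductSpace ℝ (Matrix (Fin n₁) (Fin n₂) 𝕜) := LowRank.frobeniusInnerProductSpace
  set δ := LowRank.lrip A (2 * K) with hδdef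
  have hAlt : ∀ X, X ≠ 0 → ‖A X‖ < ‖X‖ := fun X hX ↦
    (LowRank.norm_map_le_opNorm A X).trans_lt
      (mul_lt_of_lt_one_left (norm_pos_iff.2 hX) hA)
  have hAle : ∀ X, ‖A X‖ ≤ ‖X‖ := fun X ↦ by
    rcases eq_or_ne X 0 with rfl | h
    · simp
    · exact (hAlt X h).le
  have hlow : ∀ X : Matrix (Fin n₁) (Fin n₂) 𝕜, X.rank ≤ 2 * K →
      (1 - δ) * ‖X‖ ^ 2 ≤ ‖A X‖ ^ 2 := fun X hX ↦ LowRank.one_sub_lrip_mul_norm_sq_le A hX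
  have hX₀ : X₀ ≠ 0 := by
    rintro rfl
    rw [Matrix.rank_zero] at hrank
    omega
  -- The strict contraction applied to `X₀`, which is nonzero of rank at most `2K`, gives `1 - δ <
  -- 1`.
  have hδ0 : 0 < δ := by
    have h1 := hlow X₀ (by omega)
    have h2 := pow_lt_pow_left₀ (hAlt X₀ hX₀) (norm_nonneg _) two_ne_zero
    have h3 : 0 < ‖X₀‖ ^ 2 := by have := norm_pos_iff.2 hX₀; positivity
    nlinarith
  have hs : 0 < √(1 - δ) := Real.sqrt_pos.2 (by linarith)
  have hlow' : ∀ X : Matrix (Fin n₁) (Fin n₂) 𝕜, X.rank ≤ 2 * K → √(1 - δ) * ‖X‖ ≤ ‖A X‖ := by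
    intro X hX
    refine le_of_sq_le_sq ?_ (norm_nonneg _)
    rw [mul_pow, Real.sq_sqrt (by linarith)]
    exact hlow X hX
  -- the indicator of the matrices of rank at most `K`
  have hf := LowRank.isIndicator_rankIndicator (𝕜 := 𝕜) (n₁ := n₁) (n₂ := n₂) K
  have hC := LowRank.isClosed_setOf_rank_le (𝕜 := 𝕜) (m := n₁) (n := n₂) K
  have h0 : (0 : Matrix (Fin n₁) (Fin n₂) 𝕜) ∈
      {X : Matrix (Fin n₁) (Fin n₂) 𝕜 | X.rank ≤ K} := by simp
  have hmn : 0 < n₁ * n₂ := Nat.mul_pos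
    (by have := X₀.rank_le_height; omega) (by have := X₀.rank_le_width; omega)
  have hc : (0 : ℝ) < 1 / (n₁ * n₂ : ℝ) := by
    have : (0 : ℝ) < n₁ * n₂ := by exact_mod_cast hmn
    positivity
  have hcoer := LowRank.infDist_rank_le_sq_le (𝕜 := 𝕜) hK hmn
  obtain ⟨X, hXr, hXmin⟩ := LowRank.exists_isBestRank (K := K) A b hs fun X hX ↦ hlow' X (by omega)
  have hglobal : ∀ Y, LowRank.IsBestRank A b K Y →
      ∀ Z, LowRank.regFunctional A b K Y ≤ LowRank.regFunctional A b K Z :=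
    fun Y hY Z ↦ LowRank.forall_le_of_isMinOn hf hC h0 hc hcoer hAle hY.1 hY.2 Z
  have hlocal : ∀ Y, (∀ Z, LowRank.regFunctional A b K Y ≤ LowRank.regFunctional A b K Z) →
      IsLocalMin (LowRank.regFunctional A b K) Y := fun Y hY ↦ Filter.Eventually.of_forall hY
  have hmem : ∀ Y, IsLocalMin (LowRank.regFunctional A b K) Y → Y.rank ≤ K :=
    fun Y hY ↦ LowRank.mem_of_isLocalMin hf hC h0 hc hcoer hAlt hY
  have hfirst : ∀ Y, IsLocalMin (LowRank.regFunctional A b K) Y →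
      ∀ W : Matrix (Fin n₁) (Fin n₂) 𝕜, W.rank ≤ K →
        0 ≤ ‖W - Y‖ ^ 2 + 2 * inner ℝ (A Y - b) (A (W - Y)) :=
    fun Y hY W hW ↦ LowRank.first_order_of_isLocalMin hf hC hAle (hmem Y hY) hY hW
  have hXloc := hlocal X (hglobal X ⟨hXr, hXmin⟩)
  -- the distance from the best solution to `X₀`
  have hres : ‖A X - b‖ ≤ ‖ε‖ := by
    have h := hXmin X₀ hrank.le
    rwa [hb, sub_add_cancel_left, norm_neg, ← hb] at h
  have hdist : ‖X - X₀‖ ≤ 2 * ‖ε‖ / √(1 - δ) := by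
    rw [le_div_iff₀ hs, mul_comm]
    refine (hlow' (X - X₀) ((LowRank.rank_sub_le X X₀).trans (by omega))).trans ?_
    have e : A (X - X₀) = (A X - b) + ε := by
      rw [map_sub, hb]
      abel
    rw [e]
    linarith [norm_add_le (A X - b) ε]
  -- the smallest nonzero singular value of the best solution dominates the residual
  have hu : 0 < 1 - 2 * δ := by linarith
  have hgap : 2 / (1 - 2 * δ) * ‖ε‖ < LowRank.sigma X₀ K - ‖X - X₀‖ := by
    -- The `5` splits as `2 + 3`: `2/(1 - 2δ)` is the factor `τ`, and `3/(1 - 2δ) ≥ 3 ≥ 2/√(1 - δ)`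
    -- absorbs the distance to `X₀`.
    have h1 : (1 - 2 * δ) ^ (3 / 2 : ℝ) ≤ 1 - 2 * δ := by
      have := Real.rpow_le_rpow_of_exponent_ge hu (by linarith : 1 - 2 * δ ≤ 1)
        (by norm_num : (1 : ℝ) ≤ 3 / 2)
      rwa [Real.rpow_one] at this
    have h2 : 5 / (1 - 2 * δ) ≤ 5 / (1 - 2 * δ) ^ (3 / 2 : ℝ) :=
      div_le_div_of_nonneg_left (by norm_num) (Real.rpow_pos_of_pos hu _) h1
    have h3 : 2 / √(1 - δ) ≤ 3 := by
      rw [div_le_iff₀ hs]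
      have : 2 / 3 ≤ √(1 - δ) := Real.le_sqrt_of_sq_le (by norm_num; linarith)
      linarith
    have h4 : 3 ≤ 3 / (1 - 2 * δ) := by
      rw [le_div_iff₀ hu]
      linarith
    have h5 : 2 / (1 - 2 * δ) + 2 / √(1 - δ) ≤ 5 / (1 - 2 * δ) ^ (3 / 2 : ℝ) := by
      have : 5 / (1 - 2 * δ) = 2 / (1 - 2 * δ) + 3 / (1 - 2 * δ) := by ring
      linarith
    have h6 := mul_le_mul_of_nonneg_right h5 (norm_nonneg ε)
    rw [mul_div_right_comm] at hdist
    linarith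
  have hτ0 : 0 < 2 / (1 - 2 * δ) := by positivity
  have hpos : 0 < LowRank.sigma X₀ K - ‖X - X₀‖ :=
    lt_of_le_of_lt (by positivity) hgap
  have huniq : ∀ Y, IsLocalMin (LowRank.regFunctional A b K) Y → Y = X := by
    intro Y hY
    have hYr := hmem Y hY
    -- With `D = Y - X`, the condition at `Y` and the lower bound give `2⟨A X - b, A D⟩ ≤ -(1 -
    -- 2δ)‖D‖²`. The scaled condition at `X` gives `4⟨A X - b, A D⟩ ≥ -(1 - 2δ)‖D‖²`, so `D = 0`.
    -- Any `τ > 1/(1 - 2δ)` would serve here.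
    have h1 := hfirst Y hY X hXr
    have h2 := LowRank.first_order_scaled hAle hK hrank hXr hτ0.le (hfirst X hXloc) hpos
      ((mul_le_mul_of_nonneg_left hres hτ0.le).trans hgap.le) hYr
    have h3 := hlow (Y - X) ((LowRank.rank_sub_le Y X).trans (by omega))
    have e : inner ℝ (A Y - b) (A (X - Y)) = -inner ℝ (A X - b) (A (Y - X)) - ‖A (Y - X)‖ ^ 2 := by
      have e1 : A Y - b = (A X - b) + A (Y - X) := by
        rw [map_sub]
        abel
      rw [e1, ← neg_sub Y X, map_neg, inner_neg_right, inner_add_left, real_inner_self_eq_norm_sq]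
      ring
    rw [e, norm_sub_rev] at h1
    have h4 : 0 ≤ (1 - 2 * δ) * ‖Y - X‖ ^ 2 + 4 * inner ℝ (A X - b) (A (Y - X)) := by
      have := mul_nonneg hu.le h2
      have e2 : (1 - 2 * δ) * (‖Y - X‖ ^ 2 + 2 * (2 / (1 - 2 * δ)) * inner ℝ (A X - b) (A (Y - X)))
          = (1 - 2 * δ) * ‖Y - X‖ ^ 2 + 4 * inner ℝ (A X - b) (A (Y - X)) := by
        field_simp
        ring
      rwa [e2] at this
    have h5 : (1 - 2 * δ) * ‖Y - X‖ ^ 2 ≤ 0 := by linarith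
    have h6 : ‖Y - X‖ ^ 2 = 0 :=
      le_antisymm (nonpos_of_mul_nonpos_right h5 hu) (sq_nonneg _)
    exact sub_eq_zero.1 (norm_eq_zero.1 ((pow_eq_zero_iff two_ne_zero).1 h6))
  refine ⟨X, fun Y ↦ ⟨fun hY ↦ huniq Y (hlocal Y (hglobal Y hY)), ?_⟩,
    fun Y ↦ ⟨fun hY ↦ huniq Y (hlocal Y hY), ?_⟩, huniq, hdist⟩
  · rintro rfl
    exact ⟨hXr, hXmin⟩
  · rintro rfl
    exact hglobal Y ⟨hXr, hXmin⟩
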